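/- Let $\mathbb{C}^2$ carry the symplectic form $\omega=\frac1\pi(dp_0\wedge dq_0+dp_1\wedge dq_1)$, where $z_j=q_j+ip_j$, and measure areas in $\mathbb{C}\cong T^*\mathbb{R}$ by $\frac1\pi$ times the Euclidean area, so that a disc of radius $\rho$ has area $\rho^2$. Let $r>0$. Let $D\subset\mathbb{C}$ be any closed round disc of area $r^2$ (that is, of radius $r$) which does not contain the origin, let $\partial D$ be its boundary circle, and let $$\Theta_{EP}(r^2)=\{(e^{i\theta}c,\,e^{-i\theta}c)\;:\;c\in\partial D,\ \theta\in\mathbb{R}\}$$ be the Eliashberg–Polterovich torus, the orbit of the diagonal curve $\{(c,c):c\in\partial D\}$ under the circle action $(z_0,z_1)\mapsto(e^{i\theta}z_0,e^{-i\theta}z_1)$. Let $I:T^*(S^1\times\mathbb{R})\to\mathbb{C}^2$ be Chekanov's embedding, which in coordinates $\theta\in S^1$, $x\in\mathbb{R}$ and dual momenta $\tau,y$ is $$I\big((\tau,\theta),(y,x)\big)=\Big((e^{x}+ie^{-x}y)\cos\theta-i\tau e^{-x}\sin\theta,\ (e^{x}+ie^{-x}y)\sin\theta+i\tau e^{-x}\cos\theta\Big),$$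 and let $$\Theta_{Ch}(r^2)=\{I((0,\theta),(y,x))\;:\;\theta\in S^1,\ x^2+y^2=2r^2\}$$ be Chekanov's torus, the image of the product of the zero section of $T^*S^1$ with the circle centred at the origin of area $2r^2$. Then $\Theta_{EP}(r^2)$ is Hamiltonian isotopic to $\Theta_{Ch}(r^2)$ in $\mathbb{C}^2$: there is a smooth function $H:\mathbb{R}\times\mathbb{C}^2\to\mathbb{R}$, $(t,z)\mapsto H_t(z)$, with $H_t$ supported in one fixed compact set for all $t\in[0,1]$, such that the flow $(\varphi_t)_{t\in[0,1]}$, $\varphi_0=\mathrm{id}$, of the time-dependent Hamiltonian vector field $X_t$ given by $\omega(X_t,\cdot)=dH_t$ satisfies $\varphi_1(\Theta_{EP}(r^2))=\Theta_{Ch}(r^2)$. -/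

import Mathlib

open Real Set
open scoped ContDiff

/-- The standard symplectic form `ω = dλ`, `λ = (1/π) ∑ p_j dq_j`, on `ℂ²` with coordinates
`z_j = q_j + i p_j`; that is, `ω = (1/π) ∑ dp_j ∧ dq_j`. With this normalisation a disc of
radius `ρ` in `ℂ` has area `ρ²`. -/
noncomputable def omegaStd (u v : ℂ × ℂ) : ℝ :=
  ((u.1.im * v.1.re - u.1.re * v.1.im) + (u.2.im * v.2.re - u.2.re * v.2.im)) / π

/-- `φ_t`, `t ∈ [0,1]`, is a (compactly supported) Hamiltonian isotopy of `ℂ²`: it is the flow,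
started at the identity, of the time-dependent vector field `X_t` determined by
`ω(X_t, ·) = dH_t`, for a smooth function `H` with `H_t` supported in a fixed compact set for
all `t ∈ [0,1]`. Such an `X_t` is smooth with compact support, so the flow is unique, and
every `φ_t` is automatically a diffeomorphism. -/
def IsHamiltonianIsotopy (φ : ℝ → ℂ × ℂ → ℂ × ℂ) : Prop :=
  ∃ (H : ℝ → ℂ × ℂ → ℝ) (X : ℝ → ℂ × ℂ → ℂ × ℂ) (K : Set (ℂ × ℂ)),
    ContDiff ℝ ∞ (fun p : ℝ × (ℂ × ℂ) => H p.1 p.2) ∧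
    IsCompact K ∧
    (∀ t ∈ Icc (0 : ℝ) 1, ∀ z, z ∉ K → H t z = 0) ∧
    (∀ t ∈ Icc (0 : ℝ) 1, ∀ z w, omegaStd (X t z) w = fderiv ℝ (H t) z w) ∧
    (∀ z, φ 0 z = z) ∧
    (∀ z, ∀ t ∈ Icc (0 : ℝ) 1,
      HasDerivWithinAt (fun s => φ s z) (X t (φ t z)) (Icc (0 : ℝ) 1) t)

/-- Two subsets of `ℂ²` are Hamiltonian isotopic if the time-one map of a Hamiltonian isotopy
carries the first onto the second. -/
def HamiltonianIsotopic (A B : Set (ℂ × ℂ)) : Prop :=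
  ∃ φ : ℝ → ℂ × ℂ → ℂ × ℂ, IsHamiltonianIsotopy φ ∧ φ 1 '' A = B

/-- The circle action `(z₀, z₁) ↦ (e^{iθ} z₀, e^{-iθ} z₁)`. -/
noncomputable def rhoEP (θ : ℝ) (z : ℂ × ℂ) : ℂ × ℂ :=
  (Complex.exp (θ * Complex.I) * z.1, Complex.exp (-(θ * Complex.I)) * z.2)

/-- The Eliashberg–Polterovich torus `Θ_EP(r²)` built on the disc with centre `a` and radius `r`
(area `r²`): the orbit under `rhoEP` of the diagonal curve `{(c, c)}`, where `c` runs through the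
boundary circle of the disc. -/
noncomputable def thetaEP (a : ℂ) (r : ℝ) : Set (ℂ × ℂ) :=
  {w | ∃ c ∈ Metric.sphere a r, ∃ θ : ℝ, w = rhoEP θ (c, c)}

/-- Chekanov's embedding `I` of `T^*(S¹ × ℝ)` into `T^*ℝ² = ℂ²`, induced on cotangent bundles by
`(θ, x) ↦ (e^x cos θ, e^x sin θ)`, in the coordinates `((τ, θ), (y, x))`, where `θ` is an
angle and `τ`, `y` are the momenta dual to `θ`, `x`. -/
noncomputable def chekanovEmbedding (τ θ y x : ℝ) : ℂ × ℂ :=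
  ((Real.exp x + Complex.I * Real.exp (-x) * y) * Real.cos θ
      - Complex.I * τ * Real.exp (-x) * Real.sin θ,
   (Real.exp x + Complex.I * Real.exp (-x) * y) * Real.sin θ
      + Complex.I * τ * Real.exp (-x) * Real.cos θ)

/-- Chekanov's torus `Θ_Ch(r²)`: the image under Chekanov's embedding of the product of the zero
section `τ = 0` of `T^*S¹` with the circle `L` centred at the origin of `T^*ℝ` of (normalised)
area `2r²`, that is of radius `√2 r`. -/
noncomputable def thetaCh (r : ℝ) : Set (ℂ × ℂ) :=
  {w | ∃ θ x y : ℝ, x ^ 2 + y ^ 2 = 2 * r ^ 2 ∧ w = chekanovEmbedding 0 θ y x}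

/-! Both tori are orbits of a plane curve under real rotations, up to a unitary map. Modulo a phase,
the unitary path generated by the coordinate swap turns the action `rhoEP` into rotation of the real
plane. A further phase puts the centre of the circle on the positive real axis, so `thetaEP a r`
becomes the rotation torus of the circle of centre `√2‖a‖` and radius `√2 r`
(`unitaryFlow_image_thetaEP`). As `r < ‖a‖`, this circle lies in `Re > 0`.

Chekanov's torus is the rotation torus of the image of the circle of radius `√2 r` about the origin
under the cotangent lift of `exp`. The translated circle is its image under the lift of `x ↦ b + x`.
The inverses of these two maps are joined by `logHomotopy`, a convex combination of increasing
functions on `q > 0`. Lifting the resulting radial isotopy of the punctured plane to its cotangent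
bundle gives a Hamiltonian path of tori (`hamiltonianIsotopic_rotationTorus_sphere`).

Each path sweeps out a compact set, so its Hamiltonian can be cut off
(`hamiltonianIsotopic_of_trajectories`), and the two isotopies are concatenated by
`HamiltonianIsotopic.trans`. -/

open scoped Topology

/-! ### Hamiltonian vectors -/

/-- The vector `ω`-dual to a linear form: `omegaStd (hamVec L) = L`. -/
noncomputable def hamVec (L : ℂ × ℂ →L[ℝ] ℝ) : ℂ × ℂ :=
  (((-(π * L (Complex.I, 0)) : ℝ) : ℂ) + ((π * L (1, 0) : ℝ) : ℂ) * Complex.I,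
   ((-(π * L (0, Complex.I)) : ℝ) : ℂ) + ((π * L (0, 1) : ℝ) : ℂ) * Complex.I)

theorem complexPair_eq_sum (w : ℂ × ℂ) :
    w = w.1.re • ((1 : ℂ), (0 : ℂ)) + w.1.im • (Complex.I, (0 : ℂ)) +
      w.2.re • ((0 : ℂ), (1 : ℂ)) + w.2.im • ((0 : ℂ), Complex.I) := by
  ext <;> simp

theorem omegaStd_hamVec (L : ℂ × ℂ →L[ℝ] ℝ) (w : ℂ × ℂ) : omegaStd (hamVec L) w = L w := by
  conv_rhs => rw [complexPair_eq_sum w]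
  have := Real.pi_ne_zero
  simp only [map_add, map_smul, smul_eq_mul, omegaStd, hamVec, Complex.add_re, Complex.add_im,
    Complex.ofReal_re, Complex.ofReal_im, Complex.mul_re, Complex.mul_im, Complex.I_re,
    Complex.I_im]
  field_simp
  ring

theorem eq_hamVec {L : ℂ × ℂ →L[ℝ] ℝ} {u : ℂ × ℂ} (h : ∀ w, omegaStd u w = L w) :
    u = hamVec L := by
  have := Real.pi_ne_zero
  have h1 := h (1, 0)
  have h2 := h (Complex.I, 0)
  have h3 := h (0, 1)
  have h4 := h (0, Complex.I)
  simp [omegaStd] at h1 h2 h3 h4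
  ext <;> simp [hamVec, ← h1, ← h2, ← h3, ← h4] <;> field_simp <;>
    exact (Complex.re_add_im _).symm

/-! ### Cutoffs, flows, and isotopies from trajectories -/

theorem exists_contDiff_cutoff {E : Type*} [NormedAddCommGroup E] [NormedSpace ℝ E]
    [FiniteDimensional ℝ E] {K U : Set E} (hK : IsCompact K) (hU : IsOpen U) (hKU : K ⊆ U) :
    ∃ (χ : E → ℝ) (V : Set E), ContDiff ℝ ∞ χ ∧ IsCompact V ∧ V ⊆ U ∧ (∀ x ∉ V, χ x = 0) ∧
      ∀ x ∈ K, ∀ᶠ y in 𝓝 x, χ y = 1 := by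
  obtain ⟨V, hV, hKV, hVU⟩ := exists_compact_between hK hU hKU
  obtain ⟨f, hf1, hf0, -⟩ := exists_contMDiffMap_one_nhds_of_subset_interior (n := ⊤)
    (modelWithCornersSelf ℝ E) hK.isClosed hKV
  exact ⟨f, V, f.contMDiff.contDiff, hV, hVU, hf0, fun x hx =>
    (mem_nhdsSet_iff_forall.1 hf1 x hx)⟩

theorem contDiff_cutoff_mul {E : Type*} [NormedAddCommGroup E] [NormedSpace ℝ E]
    {V U : Set E} {χ H : E → ℝ} (hχ : ContDiff ℝ ∞ χ) (hU : IsOpen U) (hV : IsClosed V)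
    (hVU : V ⊆ U) (h0 : ∀ x ∉ V, χ x = 0) (hH : ContDiffOn ℝ ∞ H U) :
    ContDiff ℝ ∞ (fun x => χ x * H x) := by
  rw [contDiff_iff_contDiffAt]
  intro x
  by_cases hx : x ∈ V
  · exact hχ.contDiffAt.mul (hH.contDiffAt (hU.mem_nhds (hVU hx)))
  · refine (contDiffAt_const (c := (0 : ℝ))).congr_of_eventuallyEq ?_
    filter_upwards [hV.isOpen_compl.mem_nhds hx] with y hy
    rw [h0 y hy, zero_mul]

/-- A time-dependent Lipschitz bounded vector field has solutions on `[0,1]` for every initial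
value. -/
theorem exists_solution_Icc_of_lipschitz_of_bounded {E : Type*} [NormedAddCommGroup E]
    [NormedSpace ℝ E] [CompleteSpace E] {X : ℝ → E → E} {C L : NNReal}
    (hlip : ∀ t, LipschitzWith C (X t)) (hcont : ∀ x, Continuous fun t => X t x)
    (hbd : ∀ t x, ‖X t x‖ ≤ L) (x : E) :
    ∃ α : ℝ → E, α 0 = x ∧
      ∀ t ∈ Icc (0 : ℝ) 1, HasDerivWithinAt α (X t (α t)) (Icc (0 : ℝ) 1) t := by
  -- With speed at most `L`, a solution stays in the ball of radius `L` for unit time, so a single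
  -- Picard–Lindelöf step covers all of `[0,1]`.
  have h : IsPicardLindelof X (⟨0, by simp⟩ : Icc (0 : ℝ) 1) x L 0 L C :=
    ⟨fun t _ => (hlip t).lipschitzOnWith, fun x _ => (hcont x).continuousOn,
      fun t _ x _ => hbd t x, by simp⟩
  exact h.exists_eq_forall_mem_Icc_hasDerivWithinAt₀

theorem HasDerivWithinAt.Ici_of_Icc {E : Type*} [NormedAddCommGroup E] [NormedSpace ℝ E]
    {f : ℝ → E} {f' : E} {a b t : ℝ} (h : HasDerivWithinAt f f' (Icc a b) t)
    (ht : t ∈ Ico a b) : HasDerivWithinAt f f' (Ici t) t :=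
  h.mono_of_mem_nhdsWithin (Filter.mem_of_superset (Icc_mem_nhdsGE ht.2)
    (Icc_subset_Icc_left ht.1))

/-- Trajectories of a Hamiltonian that is only smooth near a compact set containing them are
trajectories of a compactly supported Hamiltonian isotopy. -/
theorem hamiltonianIsotopic_of_trajectories {ι : Type*} {A B : Set (ℂ × ℂ)}
    {U K : Set (ℝ × (ℂ × ℂ))} (hU : IsOpen U) (hK : IsCompact K) (hKU : K ⊆ U)
    {H : ℝ → ℂ × ℂ → ℝ} (hH : ContDiffOn ℝ ∞ (fun p : ℝ × (ℂ × ℂ) => H p.1 p.2) U)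
    (γ : ι → ℝ → ℂ × ℂ)
    (hγK : ∀ i, ∀ t ∈ Icc (0 : ℝ) 1, (t, γ i t) ∈ K)
    (hγ : ∀ i, ∀ t ∈ Icc (0 : ℝ) 1,
      HasDerivWithinAt (γ i) (hamVec (fderiv ℝ (H t) (γ i t))) (Icc (0 : ℝ) 1) t)
    (hA : range (fun i => γ i 0) = A) (hB : range (fun i => γ i 1) = B) :
    HamiltonianIsotopic A B := by
  obtain ⟨χ, V, hχ, hV, hVU, hχ0, hχ1⟩ := exists_contDiff_cutoff hK hU hKU
  set G : ℝ × (ℂ × ℂ) → ℝ := fun p => χ p * H p.1 p.2 with hG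
  have hGs : ContDiff ℝ ∞ G := contDiff_cutoff_mul hχ hU hV.isClosed hVU hχ0 hH
  have hG0 : ∀ p ∉ V, G p = 0 := fun p hp => by simp [hG, hχ0 p hp]
  have hGc : HasCompactSupport G := HasCompactSupport.intro hV hG0
  set Y : ℝ × (ℂ × ℂ) → ℂ × ℂ := fun p =>
    hamVec ((fderiv ℝ G p).comp (ContinuousLinearMap.inr ℝ ℝ (ℂ × ℂ))) with hY
  have hslice : ∀ t z, fderiv ℝ (fun z => G (t, z)) z =
      (fderiv ℝ G (t, z)).comp (ContinuousLinearMap.inr ℝ ℝ (ℂ × ℂ)) := fun t z =>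
    ((hGs.differentiable (by simp) (t, z)).hasFDerivAt.comp z
      (hasFDerivAt_prodMk_right t z)).fderiv
  have hfd : ContDiff ℝ ∞ (fderiv ℝ G) := hGs.fderiv_right (by simp)
  have hYs : ContDiff ℝ ∞ Y := by
    have happ : ∀ v, ContDiff ℝ ∞ (fun p => ((fderiv ℝ G p (0, v) : ℝ) : ℂ)) := fun v =>
      Complex.ofRealCLM.contDiff.comp (hfd.clm_apply contDiff_const)
    have h1 := happ (1, 0)
    have h2 := happ (Complex.I, 0)
    have h3 := happ (0, 1)
    have h4 := happ (0, Complex.I)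
    simp only [hY, hamVec, ContinuousLinearMap.comp_apply, ContinuousLinearMap.inr_apply,
      Complex.ofReal_neg, Complex.ofReal_mul]
    fun_prop
  have hYc : HasCompactSupport Y := by
    refine (hGc.fderiv ℝ).mono' ?_
    refine (Function.support_subset_iff'.2 fun p hp => ?_).trans subset_closure
    simp only [Function.mem_support, not_not] at hp
    simp [hY, hp, hamVec]
  obtain ⟨C, hC⟩ := hYs.lipschitzWith_of_hasCompactSupport hYc (by simp)
  obtain ⟨M, hM⟩ := hYc.exists_bound_of_continuous hYs.continuous
  have hlip : ∀ t, LipschitzWith C (fun z => Y (t, z)) := fun t =>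
    (hC.comp (LipschitzWith.prodMk_left t)).weaken (by simp)
  have hex := exists_solution_Icc_of_lipschitz_of_bounded (X := fun t z => Y (t, z))
    (L := M.toNNReal) hlip
    (fun z => hYs.continuous.comp (by fun_prop)) (fun t z => (hM _).trans (Real.le_coe_toNNReal M))
  choose α hα0 hα using hex
  -- The cutoff is 1 near every point of `K`, so it leaves the differential unchanged along each `γ
  -- i`; uniqueness then identifies `γ i` with the cut-off flow.
  have hkey : ∀ i, ∀ t ∈ Icc (0 : ℝ) 1, α (γ i 0) t = γ i t := by
    intro i
    refine ODE_solution_unique (v := fun t z => Y (t, z)) (K := C) hlip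
      (fun t ht => (hα _ t ht).continuousWithinAt)
      (fun t ht => (hα _ t (Ico_subset_Icc_self ht)).Ici_of_Icc ht)
      (fun t ht => (hγ i t ht).continuousWithinAt)
      (fun t ht => ?_) (hα0 _)
    have h := (hγ i t (Ico_subset_Icc_self ht)).Ici_of_Icc ht
    have heq : fderiv ℝ (H t) (γ i t) = fderiv ℝ (fun z => G (t, z)) (γ i t) := by
      refine Filter.EventuallyEq.fderiv_eq ?_
      have := (Continuous.prodMk_right t).continuousAt.eventually
        (hχ1 _ (hγK i t (Ico_subset_Icc_self ht)))
      filter_upwards [this] with z hz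
      simp [hG, hz]
    rw [heq, hslice] at h
    exact h
  refine ⟨fun t z => α z t, ⟨fun t z => G (t, z), fun t z => Y (t, z), Prod.snd '' V, hGs,
    hV.image continuous_snd, fun t _ z hz => hG0 _ fun h => hz ⟨_, h, rfl⟩, fun t _ z w => ?_,
    hα0, hα⟩, ?_⟩
  · rw [hslice]
    exact omegaStd_hamVec _ _
  · rw [← hA, ← hB, ← range_comp]
    congr 1
    ext1 i
    exact hkey i 1 (by simp)

/-! ### Concatenation of isotopies -/

theorem omegaStd_add_left (u v w : ℂ × ℂ) :
    omegaStd (u + v) w = omegaStd u w + omegaStd v w := by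
  simp [omegaStd]
  ring

theorem omegaStd_smul_left (c : ℝ) (u w : ℂ × ℂ) :
    omegaStd (c • u) w = c * omegaStd u w := by
  simp [omegaStd]
  ring

theorem hasDerivWithinAt_reparam {E : Type*} [NormedAddCommGroup E] [NormedSpace ℝ E]
    {f : ℝ → E} {f' : E} {β : ℝ → ℝ} {t : ℝ} (hβ : Differentiable ℝ β)
    (hβI : ∀ s, β s ∈ Icc (0 : ℝ) 1) (hf : HasDerivWithinAt f f' (Icc (0 : ℝ) 1) (β t)) :
    HasDerivWithinAt (fun s => f (β s)) (deriv β t • f') (Icc (0 : ℝ) 1) t :=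
  HasDerivWithinAt.scomp t hf (hβ t).hasDerivAt.hasDerivWithinAt fun s _ => hβI s

theorem HamiltonianIsotopic.trans {A B C : Set (ℂ × ℂ)} (hAB : HamiltonianIsotopic A B)
    (hBC : HamiltonianIsotopic B C) : HamiltonianIsotopic A C := by
  obtain ⟨φ, ⟨H₁, X₁, K₁, hH₁, hK₁, hsupp₁, hX₁, hφ0, hφ⟩, rfl⟩ := hAB
  obtain ⟨ψ, ⟨H₂, X₂, K₂, hH₂, hK₂, hsupp₂, hX₂, hψ0, hψ⟩, rfl⟩ := hBC
  -- `β₁` does all its moving on `[0,1/3]` and `β₂` on `[2/3,1]`. The flat gap between them makes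
  -- the concatenation smooth in time, and at each time at most one summand of the Hamiltonian is
  -- active.
  set β₁ : ℝ → ℝ := fun t => Real.smoothTransition (3 * t) with hβ₁
  set β₂ : ℝ → ℝ := fun t => Real.smoothTransition (3 * t - 2) with hβ₂
  have hs₁ : ContDiff ℝ ∞ β₁ := Real.smoothTransition.contDiff.comp (by fun_prop)
  have hs₂ : ContDiff ℝ ∞ β₂ := Real.smoothTransition.contDiff.comp (by fun_prop)
  have hI₁ : ∀ s, β₁ s ∈ Icc (0 : ℝ) 1 := fun s =>
    ⟨Real.smoothTransition.nonneg _, Real.smoothTransition.le_one _⟩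
  have hI₂ : ∀ s, β₂ s ∈ Icc (0 : ℝ) 1 := fun s =>
    ⟨Real.smoothTransition.nonneg _, Real.smoothTransition.le_one _⟩
  have hd₁ : ContDiff ℝ ∞ (deriv β₁) := (contDiff_infty_iff_deriv.1 hs₁).2
  have hd₂ : ContDiff ℝ ∞ (deriv β₂) := (contDiff_infty_iff_deriv.1 hs₂).2
  have hz₂ : ∀ t ≤ 2 / 3, β₂ t = 0 := fun t ht =>
    Real.smoothTransition.zero_of_nonpos (by linarith)
  have ho₁ : ∀ t, 1 / 3 ≤ t → β₁ t = 1 := fun t ht =>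
    Real.smoothTransition.one_of_one_le (by linarith)
  have hslice : ∀ (H : ℝ → ℂ × ℂ → ℝ), ContDiff ℝ ∞ (fun p : ℝ × (ℂ × ℂ) => H p.1 p.2) →
      ∀ t, Differentiable ℝ (H t) := fun H hH t =>
    (hH.comp (contDiff_prodMk_right t)).differentiable (by simp)
  refine ⟨fun t z => ψ (β₂ t) (φ (β₁ t) z),
    ⟨fun t z => deriv β₁ t * H₁ (β₁ t) z + deriv β₂ t * H₂ (β₂ t) z,
      fun t z => deriv β₁ t • X₁ (β₁ t) z + deriv β₂ t • X₂ (β₂ t) z,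
      K₁ ∪ K₂, ?_, hK₁.union hK₂, fun t _ z hz => ?_, fun t _ z w => ?_, fun z => ?_,
      fun z t ht => ?_⟩, ?_⟩
  · exact ((hd₁.comp contDiff_fst).mul (hH₁.comp ((hs₁.comp contDiff_fst).prodMk contDiff_snd))).add
      ((hd₂.comp contDiff_fst).mul (hH₂.comp ((hs₂.comp contDiff_fst).prodMk contDiff_snd)))
  · rw [mem_union, not_or] at hz
    simp only [hsupp₁ _ (hI₁ t) z hz.1, hsupp₂ _ (hI₂ t) z hz.2, mul_zero, add_zero]
  · have e := (((hslice H₁ hH₁ (β₁ t) z).hasFDerivAt.const_mul (deriv β₁ t)).add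
      ((hslice H₂ hH₂ (β₂ t) z).hasFDerivAt.const_mul (deriv β₂ t))).fderiv
    rw [omegaStd_add_left, omegaStd_smul_left, omegaStd_smul_left, hX₁ _ (hI₁ t), hX₂ _ (hI₂ t)]
    exact (congrArg (fun L : ℂ × ℂ →L[ℝ] ℝ => L w) e).symm
  · have h1 : β₁ 0 = 0 := by simp [hβ₁]
    have h2 : β₂ 0 = 0 := hz₂ 0 (by norm_num)
    simp [h1, h2, hφ0, hψ0]
  · rcases lt_or_ge t (2 / 3) with h | h
    · have hev : ∀ᶠ s in 𝓝 t, β₂ s = 0 := by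
        filter_upwards [Iio_mem_nhds h] with s hs using hz₂ s (le_of_lt hs)
      have hder : deriv β₂ t = 0 := by
        rw [Filter.EventuallyEq.deriv_eq (f := fun _ => (0 : ℝ)) hev, deriv_const]
      have := hasDerivWithinAt_reparam (hs₁.differentiable (by simp)) hI₁ (hφ z _ (hI₁ t))
      refine (this.congr_of_eventuallyEq ?_ ?_).congr_deriv ?_
      · filter_upwards [nhdsWithin_le_nhds hev] with s hs
        rw [hs, hψ0]
      · beta_reduce
        rw [hz₂ t h.le, hψ0]
      · beta_reduce
        rw [hder, hz₂ t h.le, hψ0, zero_smul, add_zero]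
    · have hlt : 1 / 3 < t := by linarith
      have hev : ∀ᶠ s in 𝓝 t, β₁ s = 1 := by
        filter_upwards [Ioi_mem_nhds hlt] with s hs using ho₁ s (le_of_lt hs)
      have hder : deriv β₁ t = 0 := by
        rw [Filter.EventuallyEq.deriv_eq (f := fun _ => (1 : ℝ)) hev, deriv_const]
      have := hasDerivWithinAt_reparam (hs₂.differentiable (by simp)) hI₂ (hψ (φ 1 z) _ (hI₂ t))
      refine (this.congr_of_eventuallyEq ?_ ?_).congr_deriv ?_
      · filter_upwards [nhdsWithin_le_nhds hev] with s hs
        rw [hs]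
      · beta_reduce
        rw [ho₁ t hlt.le]
      · beta_reduce
        rw [hder, ho₁ t hlt.le, zero_smul, zero_add]
  · have h1 : β₁ 1 = 1 := ho₁ 1 (by norm_num)
    have h2 : β₂ 1 = 1 := Real.smoothTransition.one_of_one_le (by norm_num)
    simp only [h1, h2]
    rw [image_image]

/-! ### The unitary isotopy to a rotation torus -/

/-- The orbit of `{(c, 0) : c ∈ S}` under the rotations of the real plane acting on `ℂ²`. -/
noncomputable def rotationTorus (S : Set ℂ) : Set (ℂ × ℂ) :=
  {w | ∃ c ∈ S, ∃ θ : ℝ, w = (c * Real.cos θ, c * Real.sin θ)}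

/-- The one-parameter family of unitary maps generated by `z ↦ i β z + i (π/4) (z₁, z₀)`. -/
noncomputable def unitaryFlow (β : ℝ) (t : ℝ) (z : ℂ × ℂ) : ℂ × ℂ :=
  (Complex.exp (β * t * Complex.I) *
      (Complex.cos (π / 4 * t) * z.1 + Complex.I * Complex.sin (π / 4 * t) * z.2),
    Complex.exp (β * t * Complex.I) *
      (Complex.I * Complex.sin (π / 4 * t) * z.1 + Complex.cos (π / 4 * t) * z.2))

noncomputable def unitaryHamiltonian (β : ℝ) (z : ℂ × ℂ) : ℝ :=
  β / (2 * π) * (z.1.re ^ 2 + z.1.im ^ 2 + z.2.re ^ 2 + z.2.im ^ 2) +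
    1 / 4 * (z.1.re * z.2.re + z.1.im * z.2.im)

theorem hasFDerivAt_fst_re (z : ℂ × ℂ) : HasFDerivAt (fun z : ℂ × ℂ => z.1.re)
    (Complex.reCLM.comp (ContinuousLinearMap.fst ℝ ℂ ℂ)) z :=
  (Complex.reCLM.comp (ContinuousLinearMap.fst ℝ ℂ ℂ)).hasFDerivAt

theorem hasFDerivAt_fst_im (z : ℂ × ℂ) : HasFDerivAt (fun z : ℂ × ℂ => z.1.im)
    (Complex.imCLM.comp (ContinuousLinearMap.fst ℝ ℂ ℂ)) z :=
  (Complex.imCLM.comp (ContinuousLinearMap.fst ℝ ℂ ℂ)).hasFDerivAt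

theorem hasFDerivAt_snd_re (z : ℂ × ℂ) : HasFDerivAt (fun z : ℂ × ℂ => z.2.re)
    (Complex.reCLM.comp (ContinuousLinearMap.snd ℝ ℂ ℂ)) z :=
  (Complex.reCLM.comp (ContinuousLinearMap.snd ℝ ℂ ℂ)).hasFDerivAt

theorem hasFDerivAt_snd_im (z : ℂ × ℂ) : HasFDerivAt (fun z : ℂ × ℂ => z.2.im)
    (Complex.imCLM.comp (ContinuousLinearMap.snd ℝ ℂ ℂ)) z :=
  (Complex.imCLM.comp (ContinuousLinearMap.snd ℝ ℂ ℂ)).hasFDerivAt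

theorem hamVec_fderiv_eq {f : ℂ × ℂ → ℝ} {L : ℂ × ℂ →L[ℝ] ℝ} {z u : ℂ × ℂ}
    (hf : HasFDerivAt f L z) (h : ∀ w, omegaStd u w = L w) : hamVec (fderiv ℝ f z) = u := by
  rw [hf.fderiv, ← eq_hamVec h]

theorem hamVec_fderiv_unitaryHamiltonian (β : ℝ) (z : ℂ × ℂ) :
    hamVec (fderiv ℝ (unitaryHamiltonian β) z) =
      (Complex.I * (β * z.1 + (π / 4 : ℝ) * z.2), Complex.I * (β * z.2 + (π / 4 : ℝ) * z.1)) := by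
  have hπ := Real.pi_ne_zero
  have hf := ((((((hasFDerivAt_fst_re z).pow 2).add ((hasFDerivAt_fst_im z).pow 2)).add
    ((hasFDerivAt_snd_re z).pow 2)).add ((hasFDerivAt_snd_im z).pow 2)).const_mul
      (β / (2 * π))).add ((((hasFDerivAt_fst_re z).mul (hasFDerivAt_snd_re z)).add
        ((hasFDerivAt_fst_im z).mul (hasFDerivAt_snd_im z))).const_mul (1 / 4))
  refine hamVec_fderiv_eq hf fun w => ?_
  simp [omegaStd]
  field_simp
  ring

theorem hasDerivAt_unitaryFlow (β t : ℝ) (z : ℂ × ℂ) :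
    HasDerivAt (fun t => unitaryFlow β t z)
      (hamVec (fderiv ℝ (unitaryHamiltonian β) (unitaryFlow β t z))) t := by
  rw [hamVec_fderiv_unitaryHamiltonian]
  have hlin : ∀ k : ℂ, HasDerivAt (fun s : ℂ => k * s) k (t : ℂ) := fun k => by
    simpa using (hasDerivAt_id (t : ℂ)).const_mul k
  have he := ((hlin β).mul_const Complex.I).cexp
  have hc := (hlin (π / 4)).ccos
  have hs := (hlin (π / 4)).csin
  have h1 := (he.mul ((hc.mul_const z.1).add ((hs.const_mul Complex.I).mul_const z.2))).comp_ofReal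
  have h2 := (he.mul (((hs.const_mul Complex.I).mul_const z.1).add (hc.mul_const z.2))).comp_ofReal
  refine (h1.prodMk h2).congr_deriv ?_
  simp only [unitaryFlow, Pi.add_apply]
  push_cast
  ext1
  · linear_combination (-Complex.exp (β * t * Complex.I) * (π / 4) *
      Complex.sin (π / 4 * t) * z.1) * Complex.I_sq
  · linear_combination (-Complex.exp (β * t * Complex.I) * (π / 4) *
      Complex.sin (π / 4 * t) * z.2) * Complex.I_sq

theorem hamiltonianIsotopic_unitaryFlow (β : ℝ) {A : Set (ℂ × ℂ)} (hA : Bornology.IsBounded A) :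
    HamiltonianIsotopic A (unitaryFlow β 1 '' A) := by
  obtain ⟨R, hR⟩ := hA.subset_closedBall 0
  have hcont : Continuous fun p : ℝ × (ℂ × ℂ) => (p.1, unitaryFlow β p.1 p.2) := by
    unfold unitaryFlow
    fun_prop
  refine hamiltonianIsotopic_of_trajectories (U := univ) (H := fun _ => unitaryHamiltonian β)
    isOpen_univ
    ((isCompact_Icc.prod (isCompact_closedBall (0 : ℂ × ℂ) R)).image hcont) (subset_univ _)
    ?_ (fun (z : A) t => unitaryFlow β t z) (fun z t ht => ⟨(t, z), ⟨ht, hR z.2⟩, rfl⟩)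
    (fun z t _ => (hasDerivAt_unitaryFlow β t z).hasDerivWithinAt) ?_ ?_
  · have h1 : ContDiff ℝ ∞ (fun p : ℝ × (ℂ × ℂ) => p.2.1.re) :=
      Complex.reCLM.contDiff.comp (by fun_prop)
    have h2 : ContDiff ℝ ∞ (fun p : ℝ × (ℂ × ℂ) => p.2.1.im) :=
      Complex.imCLM.contDiff.comp (by fun_prop)
    have h3 : ContDiff ℝ ∞ (fun p : ℝ × (ℂ × ℂ) => p.2.2.re) :=
      Complex.reCLM.contDiff.comp (by fun_prop)
    have h4 : ContDiff ℝ ∞ (fun p : ℝ × (ℂ × ℂ) => p.2.2.im) :=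
      Complex.imCLM.contDiff.comp (by fun_prop)
    unfold unitaryHamiltonian
    exact ContDiff.contDiffOn (by fun_prop)
  · simp [unitaryFlow]
  · rw [image_eq_range]

theorem isBounded_thetaEP (a : ℂ) (r : ℝ) : Bornology.IsBounded (thetaEP a r) := by
  refine (Metric.isBounded_closedBall (x := (0 : ℂ × ℂ)) (r := ‖a‖ + r)).subset ?_
  rintro w ⟨c, hc, θ, rfl⟩
  have hc' : ‖c‖ ≤ ‖a‖ + r := by
    rw [mem_sphere_iff_norm] at hc
    rw [← hc]
    exact norm_le_norm_add_norm_sub' c a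
  have h : Complex.exp (-(θ * Complex.I)) = Complex.exp ((-θ : ℝ) * Complex.I) := by simp
  simp [rhoEP, Prod.norm_def, h, Complex.norm_exp_ofReal_mul_I, -Complex.ofReal_neg, hc']

/-- The swap part at time one gives `e^{iθ} + i e^{-iθ} = 2 e^{iπ/4} cos(π/4 - θ)`, and likewise
with `sin` in the second coordinate. The phase `-π/4` in `β` cancels `e^{iπ/4}`, and `-α` is left
free to rotate the curve. -/
theorem unitaryFlow_one_rhoEP (α θ : ℝ) (c : ℂ) :
    unitaryFlow (-(π / 4) - α) 1 (rhoEP θ (c, c)) =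
      ((√2 : ℝ) * (Complex.exp (-α * Complex.I) * c) * (Real.cos (π / 4 - θ) : ℝ),
        (√2 : ℝ) * (Complex.exp (-α * Complex.I) * c) * (Real.sin (π / 4 - θ) : ℝ)) := by
  have hc : Complex.cos ((π : ℂ) / 4) = (√2 : ℝ) / 2 := by
    rw [show (π : ℂ) / 4 = ((π / 4 : ℝ) : ℂ) by push_cast; ring, ← Complex.ofReal_cos,
      Real.cos_pi_div_four]
    push_cast; ring
  have hs : Complex.sin ((π : ℂ) / 4) = (√2 : ℝ) / 2 := by
    rw [show (π : ℂ) / 4 = ((π / 4 : ℝ) : ℂ) by push_cast; ring, ← Complex.ofReal_sin,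
      Real.sin_pi_div_four]
    push_cast; ring
  have he : Complex.exp (((-(π / 4) - α : ℝ) : ℂ) * (1 : ℝ) * Complex.I) =
      (√2 : ℝ) / 2 * (1 - Complex.I) * Complex.exp (-α * Complex.I) := by
    rw [show ((-(π / 4) - α : ℝ) : ℂ) * (1 : ℝ) * Complex.I =
      -((π : ℂ) / 4) * Complex.I + -α * Complex.I by push_cast; ring, Complex.exp_add,
      Complex.exp_mul_I, Complex.cos_neg, Complex.sin_neg, hc, hs]
    ring
  have hθ : Complex.exp (θ * Complex.I) = Complex.cos θ + Complex.sin θ * Complex.I :=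
    Complex.exp_mul_I _
  have hθ' : Complex.exp (-(θ * Complex.I)) = Complex.cos θ - Complex.sin θ * Complex.I := by
    rw [← neg_mul, Complex.exp_mul_I, Complex.cos_neg, Complex.sin_neg]
    ring
  simp only [unitaryFlow, rhoEP]
  rw [he]
  simp only [hθ, hθ', Complex.ofReal_cos, Complex.ofReal_sin,
    Complex.ofReal_sub, Complex.ofReal_div, Complex.ofReal_ofNat, Complex.cos_sub,
    Complex.sin_sub, hc, hs, Complex.ofReal_one, mul_one]
  generalize Complex.exp (-α * Complex.I) = E
  generalize ((√2 : ℝ) : ℂ) = S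
  generalize Complex.cos θ = C
  generalize Complex.sin θ = D
  ext1
  · linear_combination (S ^ 2 * E * c / 4 * (-C - 2 * D + D * Complex.I)) * Complex.I_sq
  · linear_combination (S ^ 2 * E * c / 4 * (-C + 2 * D - D * Complex.I)) * Complex.I_sq

theorem unitaryFlow_image_thetaEP (a : ℂ) (r : ℝ) :
    unitaryFlow (-(π / 4) - a.arg) 1 '' thetaEP a r =
      rotationTorus (Metric.sphere ((√2 * ‖a‖ : ℝ) : ℂ) (√2 * r)) := by
  set u : ℂ := Complex.exp (-a.arg * Complex.I) with hu
  have hun : ‖u‖ = 1 := by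
    rw [hu, ← Complex.ofReal_neg, Complex.norm_exp_ofReal_mul_I]
  have hu0 : u ≠ 0 := Complex.exp_ne_zero _
  have hua : u * a = ‖a‖ := by
    conv_lhs => rw [← Complex.norm_mul_exp_arg_mul_I a]
    rw [hu, mul_left_comm, ← Complex.exp_add]
    simp
  have hS : (0 : ℝ) < √2 := by positivity
  have hmem : ∀ c, c ∈ Metric.sphere a r ↔
      (√2 : ℝ) * (u * c) ∈ Metric.sphere ((√2 * ‖a‖ : ℝ) : ℂ) (√2 * r) := fun c => by
    rw [mem_sphere_iff_norm, mem_sphere_iff_norm, Complex.ofReal_mul, ← hua, ← mul_sub, ← mul_sub,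
      norm_mul, norm_mul, hun, one_mul, Complex.norm_real, Real.norm_eq_abs, abs_of_pos hS,
      mul_right_inj' hS.ne']
  ext w
  constructor
  · rintro ⟨_, ⟨c, hc, θ, rfl⟩, rfl⟩
    exact ⟨_, (hmem c).1 hc, π / 4 - θ, unitaryFlow_one_rhoEP _ _ _⟩
  · rintro ⟨c, hc, θ, rfl⟩
    have hS' : ((√2 : ℝ) : ℂ) ≠ 0 := Complex.ofReal_ne_zero.2 hS.ne'
    have e : (√2 : ℝ) * (u * (u⁻¹ * (c / (√2 : ℝ)))) = c := by field_simp
    refine ⟨_, ⟨u⁻¹ * (c / (√2 : ℝ)), (hmem _).2 (e.symm ▸ hc), π / 4 - θ, rfl⟩, ?_⟩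
    rw [unitaryFlow_one_rhoEP, ← hu, e, sub_sub_cancel]

/-! ### The logarithmic homotopy and its velocity -/

/-- The implicit function theorem for a real function of two real variables. -/
theorem exists_implicit_of_contDiffAt {F : ℝ × ℝ → ℝ} {t₀ q₀ A D : ℝ}
    (hF : ContDiffAt ℝ 1 F (t₀, q₀)) (hA : HasDerivAt (fun t => F (t, q₀)) A t₀)
    (hD : HasDerivAt (fun q => F (t₀, q)) D q₀) (hD0 : D ≠ 0) :
    ∃ ψ : ℝ → ℝ, ψ t₀ = q₀ ∧ (∀ᶠ t in 𝓝 t₀, F (t, ψ t) = F (t₀, q₀)) ∧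
      HasDerivAt ψ (-A / D) t₀ := by
  have hfd := (hF.differentiableAt one_ne_zero).hasFDerivAt
  have hA' : fderiv ℝ F (t₀, q₀) (1, 0) = A :=
    (hfd.comp_hasDerivAt t₀ ((hasDerivAt_id t₀).prodMk (hasDerivAt_const t₀ q₀))).unique hA
  have hD' : fderiv ℝ F (t₀, q₀) (0, 1) = D :=
    (hfd.comp_hasDerivAt q₀ ((hasDerivAt_const q₀ t₀).prodMk (hasDerivAt_id q₀))).unique hD
  have hinv : (fderiv ℝ F (t₀, q₀) ∘L .inr ℝ ℝ ℝ).IsInvertible := by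
    refine ContinuousLinearMap.IsInvertible.of_inverse
      (g := D⁻¹ • ContinuousLinearMap.id ℝ ℝ) ?_ ?_ <;>
    · ext
      simp [hD', hD0]
  have hψ := (hF.hasStrictFDerivAt_implicitFunction one_ne_zero hinv).hasFDerivAt.hasDerivAt
  have hev := hF.eventually_apply_implicitFunction one_ne_zero hinv
  have h0 := hF.implicitFunction_apply_self one_ne_zero hinv
  generalize hF.implicitFunction one_ne_zero hinv = ψ at hψ hev h0
  refine ⟨ψ, h0, hev, ?_⟩
  -- The inverse operator in the derivative formula is never computed: `d` is recovered by
  -- differentiating the constant `F (t, ψ t)`.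
  generalize ((-(fderiv ℝ F (t₀, q₀) ∘L .inr ℝ ℝ ℝ).inverse ∘L
    (fderiv ℝ F (t₀, q₀) ∘L .inl ℝ ℝ ℝ)) : ℝ →L[ℝ] ℝ) 1 = d at hψ
  dsimp only at hψ hev h0
  have hfd' : HasFDerivAt F (fderiv ℝ F (t₀, q₀)) (t₀, ψ t₀) := by rwa [h0]
  have hc := hfd'.comp_hasDerivAt t₀ ((hasDerivAt_id t₀).prodMk hψ)
  have hzero : fderiv ℝ F (t₀, q₀) (1, d) = 0 :=
    hc.unique ((hasDerivAt_const t₀ (F (t₀, q₀))).congr_of_eventuallyEq hev)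
  have hsplit : ((1 : ℝ), d) = (1, 0) + d • ((0 : ℝ), (1 : ℝ)) := by simp
  rw [hsplit, map_add, map_smul, hA', hD', smul_eq_mul] at hzero
  have hd : d = -A / D := by
    field_simp
    linarith
  rwa [← hd]

/-- The homotopy from the translation `q ↦ q - b` to the logarithm. -/
noncomputable def logHomotopy (b t q : ℝ) : ℝ := (1 - t) * (q - b) + t * Real.log q

/-- The velocity at time `t` of the inverse diffeomorphism of `logHomotopy b t`, divided by the
position. -/
noncomputable def logRate (b t q : ℝ) : ℝ := (q - b - Real.log q) / ((1 - t) * q + t)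

theorem logHomotopy_denom_pos {t q : ℝ} (ht : t ∈ Icc (0 : ℝ) 1) (hq : 0 < q) :
    0 < (1 - t) * q + t := by
  rcases ht.1.eq_or_lt with rfl | h
  · simpa using hq
  · have := mul_nonneg (sub_nonneg.2 ht.2) hq.le
    linarith

theorem strictMonoOn_logHomotopy (b : ℝ) {t : ℝ} (ht : t ∈ Icc (0 : ℝ) 1) :
    StrictMonoOn (logHomotopy b t) (Ioi 0) := by
  intro q hq q' hq' h
  have hl := Real.log_lt_log hq h
  unfold logHomotopy
  rcases ht.1.eq_or_lt with rfl | h0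
  · linarith
  · have h1 := mul_le_mul_of_nonneg_left h.le (sub_nonneg.2 ht.2)
    have h2 := mul_lt_mul_of_pos_left hl h0
    linarith

theorem hasDerivAt_logHomotopy (b t : ℝ) {q : ℝ} (hq : 0 < q) :
    HasDerivAt (logHomotopy b t) ((1 - t) + t / q) q := by
  have := (((hasDerivAt_id q).sub_const b).const_mul (1 - t)).add
    ((Real.hasDerivAt_log hq.ne').const_mul t)
  exact this.congr_deriv (by ring)

theorem hasDerivAt_logHomotopy_time (b t q : ℝ) :
    HasDerivAt (fun t => logHomotopy b t q) (Real.log q - (q - b)) t := by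
  have := (((hasDerivAt_id t).const_sub 1).mul_const (q - b)).add
    ((hasDerivAt_id t).mul_const (Real.log q))
  exact this.congr_deriv (by ring)

/-- At the lower endpoint both `q - b` and `log q` are at most `-ρ`, and at the upper one both are
at least `ρ`, so every convex combination takes the value `x` in between. The bounds do not depend
on `t` or `x`, which keeps the swept set compact and away from `q = 0`. -/
theorem exists_logHomotopy_eq {b ρ x t : ℝ} (hb : ρ < b) (hx : |x| ≤ ρ)
    (ht : t ∈ Icc (0 : ℝ) 1) :
    ∃ q ∈ Icc (min (b - ρ) (Real.exp (-ρ))) (max (b + ρ) (Real.exp ρ)),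
      logHomotopy b t q = x := by
  set m := min (b - ρ) (Real.exp (-ρ)) with hm
  set M := max (b + ρ) (Real.exp ρ) with hM
  have hx' := abs_le.1 hx
  have hm0 : 0 < m := lt_min (by linarith) (Real.exp_pos _)
  have hM0 : 0 < M := lt_max_of_lt_right (Real.exp_pos _)
  have hmM : m ≤ M := (min_le_left _ _).trans (le_trans (by linarith) (le_max_left _ _))
  have hlow : logHomotopy b t m ≤ -ρ := by
    have h1 : m - b ≤ -ρ := by linarith [min_le_left (b - ρ) (Real.exp (-ρ))]
    have h2 : Real.log m ≤ -ρ := (Real.log_le_iff_le_exp hm0).2 (min_le_right _ _)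
    have h3 := mul_le_mul_of_nonneg_left h1 (sub_nonneg.2 ht.2)
    have h4 := mul_le_mul_of_nonneg_left h2 ht.1
    unfold logHomotopy
    linarith
  have hhigh : ρ ≤ logHomotopy b t M := by
    have h1 : ρ ≤ M - b := by linarith [le_max_left (b + ρ) (Real.exp ρ)]
    have h2 : ρ ≤ Real.log M := (Real.le_log_iff_exp_le hM0).2 (le_max_right _ _)
    have h3 := mul_le_mul_of_nonneg_left h1 (sub_nonneg.2 ht.2)
    have h4 := mul_le_mul_of_nonneg_left h2 ht.1
    unfold logHomotopy
    linarith
  exact intermediate_value_Icc hmM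
    (fun q hq => (hasDerivAt_logHomotopy b t (hm0.trans_le hq.1)).continuousAt.continuousWithinAt)
    ⟨hlow.trans hx'.1, hx'.2.trans hhigh⟩

/-- A curve along which `logHomotopy` is constant solves the equation with rate `logRate`. -/
theorem hasDerivWithinAt_of_logHomotopy_eq {b x : ℝ} {q : ℝ → ℝ}
    (hq0 : ∀ t ∈ Icc (0 : ℝ) 1, 0 < q t)
    (hq : ∀ t ∈ Icc (0 : ℝ) 1, logHomotopy b t (q t) = x) {t : ℝ} (ht : t ∈ Icc (0 : ℝ) 1) :
    HasDerivWithinAt q (q t * logRate b t (q t)) (Icc (0 : ℝ) 1) t := by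
  have hqt := hq0 t ht
  have hden := logHomotopy_denom_pos ht hqt
  have hF : ContDiffAt ℝ 1 (fun p : ℝ × ℝ => logHomotopy b p.1 p.2) (t, q t) := by
    unfold logHomotopy
    have := (contDiffAt_snd (𝕜 := ℝ) (n := 1) (p := (t, q t))).log hqt.ne'
    fun_prop
  have hD0 : (1 - t) + t / q t ≠ 0 := by
    have : (1 - t) + t / q t = ((1 - t) * q t + t) / q t := by field_simp
    rw [this]
    positivity
  -- No regularity of `q` is assumed: strict monotonicity forces it to agree near `t` with the
  -- differentiable implicit solution `ψ`.
  obtain ⟨ψ, hψ0, hψ, hψ'⟩ := exists_implicit_of_contDiffAt hF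
    (hasDerivAt_logHomotopy_time b t (q t)) (hasDerivAt_logHomotopy b t hqt) hD0
  have hpos : ∀ᶠ s in 𝓝 t, 0 < ψ s :=
    hψ'.continuousAt.eventually (by rw [hψ0]; exact Ioi_mem_nhds hqt)
  refine (hψ'.hasDerivWithinAt.congr_of_eventuallyEq ?_ hψ0.symm).congr_deriv ?_
  · filter_upwards [nhdsWithin_le_nhds hpos, nhdsWithin_le_nhds hψ, self_mem_nhdsWithin]
      with s hs1 hs2 hs
    refine (strictMonoOn_logHomotopy b hs).injOn (hq0 s hs) hs1 ?_
    rw [hs2, hq s hs, hq t ht]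
  · unfold logRate
    field_simp
    ring

theorem hasDerivAt_logRate (b t : ℝ) {q : ℝ} (hq : 0 < q) (hden : 0 < (1 - t) * q + t) :
    HasDerivAt (logRate b t)
      (((1 - 1 / q) - logRate b t q * (1 - t)) / ((1 - t) * q + t)) q := by
  have h1 := (((hasDerivAt_id q).sub_const b).sub (Real.hasDerivAt_log hq.ne')).div
    (((hasDerivAt_id q).const_mul (1 - t)).add_const t) hden.ne'
  refine h1.congr_deriv ?_
  have hden' : q * (1 - t) + t ≠ 0 := by linarith
  simp only [logRate, id, Pi.sub_apply]
  field_simp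

/-! ### The cotangent lift of the radial isotopy -/

/-- The Hamiltonian of the cotangent lift of the radial vector field on the plane with rate
`logRate`. -/
noncomputable def radialHamiltonian (b t : ℝ) (z : ℂ × ℂ) : ℝ :=
  -(1 / π) * (logRate b t (√(z.1.re ^ 2 + z.2.re ^ 2)) *
    (z.1.re * z.1.im + z.2.re * z.2.im))

/-- The region on which `radialHamiltonian` is smooth. -/
def radialDomain : Set (ℝ × (ℂ × ℂ)) :=
  {p | 0 < p.2.1.re ^ 2 + p.2.2.re ^ 2 ∧
    0 < (1 - p.1) * √(p.2.1.re ^ 2 + p.2.2.re ^ 2) + p.1}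

theorem isOpen_radialDomain : IsOpen radialDomain := by
  have h : Continuous fun p : ℝ × (ℂ × ℂ) => p.2.1.re ^ 2 + p.2.2.re ^ 2 :=
    ((Complex.continuous_re.comp (by fun_prop)).pow 2).add
      ((Complex.continuous_re.comp (by fun_prop)).pow 2)
  exact (isOpen_lt continuous_const h).inter (isOpen_lt continuous_const
    (((continuous_const.sub continuous_fst).mul h.sqrt).add continuous_fst))

theorem contDiffOn_radialHamiltonian (b : ℝ) : ContDiffOn ℝ ∞
    (fun p : ℝ × (ℂ × ℂ) => radialHamiltonian b p.1 p.2) radialDomain := by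
  rintro ⟨t, z⟩ ⟨h1, h2⟩
  refine ContDiffAt.contDiffWithinAt ?_
  have e1 : ContDiff ℝ ∞ (fun p : ℝ × (ℂ × ℂ) => p.2.1.re) :=
    Complex.reCLM.contDiff.comp (by fun_prop)
  have e2 : ContDiff ℝ ∞ (fun p : ℝ × (ℂ × ℂ) => p.2.1.im) :=
    Complex.imCLM.contDiff.comp (by fun_prop)
  have e3 : ContDiff ℝ ∞ (fun p : ℝ × (ℂ × ℂ) => p.2.2.re) :=
    Complex.reCLM.contDiff.comp (by fun_prop)
  have e4 : ContDiff ℝ ∞ (fun p : ℝ × (ℂ × ℂ) => p.2.2.im) :=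
    Complex.imCLM.contDiff.comp (by fun_prop)
  have hR : ContDiffAt ℝ ∞ (fun p : ℝ × (ℂ × ℂ) => √(p.2.1.re ^ 2 + p.2.2.re ^ 2)) (t, z) :=
    ((e1.pow 2).add (e3.pow 2)).contDiffAt.sqrt h1.ne'
  have hlog := hR.log (Real.sqrt_pos.2 h1).ne'
  have hnum := (hR.sub (contDiffAt_const (c := b))).sub hlog
  have hden := ((contDiffAt_const (c := (1 : ℝ)).sub contDiffAt_fst).mul hR).add contDiffAt_fst
  exact contDiffAt_const.mul ((hnum.div hden h2.ne').mul
    ((e1.mul e2).add (e3.mul e4)).contDiffAt)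

theorem sqrt_mul_cos_sq_add_mul_sin_sq {q : ℝ} (hq : 0 < q) (θ : ℝ) :
    √((q * Real.cos θ) ^ 2 + (q * Real.sin θ) ^ 2) = q := by
  rw [show (q * Real.cos θ) ^ 2 + (q * Real.sin θ) ^ 2 = q ^ 2 * (Real.sin θ ^ 2 + Real.cos θ ^ 2)
    by ring, Real.sin_sq_add_cos_sq, mul_one, Real.sqrt_sq hq.le]

/-- Where position and momentum lie on the same real line, the field reduces to the one-dimensional
lift of the velocity `v = q W`: position moves by `v` and momentum by `-p ∂v/∂q`. The minus sign in
the Hamiltonian comes from `ω(X, ·) = dH` with `ω = (1/π) dp ∧ dq`. -/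
theorem hamVec_fderiv_radialHamiltonian {b t q W' : ℝ} (hq : 0 < q)
    (hW : HasDerivAt (logRate b t) W' q) (p θ : ℝ) :
    hamVec (fderiv ℝ (radialHamiltonian b t)
      ((q + p * Complex.I) * Real.cos θ, (q + p * Complex.I) * Real.sin θ)) =
    (((q * logRate b t q : ℝ) + (-(p * (logRate b t q + q * W')) : ℝ) * Complex.I) * Real.cos θ,
      ((q * logRate b t q : ℝ) + (-(p * (logRate b t q + q * W')) : ℝ) * Complex.I) *
        Real.sin θ) := by
  set z : ℂ × ℂ :=
    (((q + p * Complex.I) * Real.cos θ : ℂ), ((q + p * Complex.I) * Real.sin θ : ℂ)) with hz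
  have hz1 : z.1.re = q * Real.cos θ := by simp [hz, -Complex.ofReal_cos]
  have hz2 : z.1.im = p * Real.cos θ := by simp [hz, -Complex.ofReal_cos]
  have hz3 : z.2.re = q * Real.sin θ := by simp [hz, -Complex.ofReal_sin]
  have hz4 : z.2.im = p * Real.sin θ := by simp [hz, -Complex.ofReal_sin]
  have hsqrt : √(z.1.re ^ 2 + z.2.re ^ 2) = q := by
    rw [hz1, hz3, sqrt_mul_cos_sq_add_mul_sin_sq hq]
  have hpos : z.1.re ^ 2 + z.2.re ^ 2 ≠ 0 := fun h => by
    rw [h, Real.sqrt_zero] at hsqrt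
    exact hq.ne hsqrt
  have hR := (((hasFDerivAt_fst_re z).pow 2).add ((hasFDerivAt_snd_re z).pow 2)).sqrt hpos
  rw [← hsqrt] at hW
  have hf := ((hW.comp_hasFDerivAt z hR).mul
    (((hasFDerivAt_fst_re z).mul (hasFDerivAt_fst_im z)).add
      ((hasFDerivAt_snd_re z).mul (hasFDerivAt_snd_im z)))).const_mul (-(1 / π))
  refine hamVec_fderiv_eq hf fun w => ?_
  have hπ := Real.pi_ne_zero
  have hcs := Real.sin_sq_add_cos_sq θ
  simp [omegaStd, hz1, hz2, hz3, hz4, -Complex.ofReal_cos, -Complex.ofReal_sin]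
  field_simp
  rw [add_comm (Real.cos θ ^ 2), hcs, mul_one, Real.sqrt_sq hq.le]
  field_simp
  ring

theorem norm_mul_ofReal_le_of_abs_le {q p M P s : ℝ} (hq : |q| ≤ M) (hp : |p| ≤ P)
    (hs : |s| ≤ 1) : ‖(q + p * Complex.I : ℂ) * (s : ℂ)‖ ≤ M + P := by
  have h : ‖(q + p * Complex.I : ℂ)‖ ≤ M + P := by
    refine (norm_add_le _ _).trans ?_
    simpa using add_le_add hq hp
  rw [norm_mul, Complex.norm_real, Real.norm_eq_abs]
  exact (mul_le_of_le_one_right (norm_nonneg _) hs).trans h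

theorem hamiltonianIsotopic_rotationTorus_sphere {b ρ : ℝ} (hρ : 0 ≤ ρ) (hb : ρ < b) :
    HamiltonianIsotopic (rotationTorus (Metric.sphere (b : ℂ) ρ))
      (rotationTorus {c | ∃ x y : ℝ, x ^ 2 + y ^ 2 = ρ ^ 2 ∧
        c = Real.exp x + Complex.I * Real.exp (-x) * y}) := by
  obtain ⟨m, hm⟩ : ∃ m, m = min (b - ρ) (Real.exp (-ρ)) := ⟨_, rfl⟩
  obtain ⟨M, hM⟩ : ∃ M, M = max (b + ρ) (Real.exp ρ) := ⟨_, rfl⟩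
  have hm0 : 0 < m := hm ▸ lt_min (by linarith) (Real.exp_pos _)
  have hex : ∀ x t : ℝ, ∃ q : ℝ, |x| ≤ ρ → t ∈ Icc (0 : ℝ) 1 →
      q ∈ Icc m M ∧ logHomotopy b t q = x := fun x t => by
    by_cases h : |x| ≤ ρ ∧ t ∈ Icc (0 : ℝ) 1
    · obtain ⟨q, hq, hqx⟩ := exists_logHomotopy_eq hb h.1 h.2
      exact ⟨q, fun _ _ => ⟨hm ▸ hM ▸ hq, hqx⟩⟩
    -- A junk value outside the relevant range makes `Q` total.
    · exact ⟨0, fun h1 h2 => (h ⟨h1, h2⟩).elim⟩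
  choose Q hQ using hex
  have hxρ : ∀ {x y : ℝ}, x ^ 2 + y ^ 2 = ρ ^ 2 → |x| ≤ ρ := fun {x y} h =>
    abs_le_of_sq_le_sq (by nlinarith [sq_nonneg y]) hρ
  have hyρ : ∀ {x y : ℝ}, x ^ 2 + y ^ 2 = ρ ^ 2 → |y| ≤ ρ := fun {x y} h =>
    abs_le_of_sq_le_sq (by nlinarith [sq_nonneg x]) hρ
  have hQpos : ∀ {x t : ℝ}, |x| ≤ ρ → t ∈ Icc (0 : ℝ) 1 → 0 < Q x t := fun hx ht =>
    hm0.trans_le (hQ _ _ hx ht).1.1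
  have hQ0 : ∀ {x : ℝ}, |x| ≤ ρ → Q x 0 = b + x := fun {x} hx => by
    have := (hQ x 0 hx (by simp)).2
    simp only [logHomotopy] at this
    linarith
  have hQ1 : ∀ {x : ℝ}, |x| ≤ ρ → Q x 1 = Real.exp x := fun {x} hx => by
    have h := (hQ x 1 hx (by simp)).2
    simp only [logHomotopy, sub_self, zero_mul, zero_add, one_mul] at h
    rw [← h, Real.exp_log (hQpos hx (by simp)), h]
  -- The lifted momentum is `y` times the `q`-derivative of `logHomotopy`: it equals `y` at time 0
  -- and `e^{-x} y` at time 1.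
  set P : ℝ → ℝ → ℝ → ℝ := fun x y t => y * ((1 - t) + t / Q x t) with hP
  set Z : ℝ → ℝ → ℝ → ℂ := fun x y t => (Q x t : ℂ) + (P x y t : ℂ) * Complex.I with hZ
  set R : ℝ := M + ρ * (1 + 1 / m) with hR
  set K : Set (ℝ × (ℂ × ℂ)) := Icc (0 : ℝ) 1 ×ˢ
    (Metric.closedBall 0 R ∩ {z | m ^ 2 ≤ z.1.re ^ 2 + z.2.re ^ 2}) with hK
  have hre : Continuous fun z : ℂ × ℂ => z.1.re ^ 2 + z.2.re ^ 2 :=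
    ((Complex.continuous_re.comp continuous_fst).pow 2).add
      ((Complex.continuous_re.comp continuous_snd).pow 2)
  have hKc : IsCompact K := isCompact_Icc.prod
    ((isCompact_closedBall _ _).inter_right (isClosed_le continuous_const hre))
  refine hamiltonianIsotopic_of_trajectories (ι := {p : ℝ × ℝ // p.1 ^ 2 + p.2 ^ 2 = ρ ^ 2} × ℝ)
    isOpen_radialDomain hKc ?_ (contDiffOn_radialHamiltonian b)
    (fun i t => (Z i.1.1.1 i.1.1.2 t * Real.cos i.2, Z i.1.1.1 i.1.1.2 t * Real.sin i.2))
    ?_ ?_ ?_ ?_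
  · rintro ⟨t, z⟩ ⟨ht, -, hz⟩
    have hz' : 0 < z.1.re ^ 2 + z.2.re ^ 2 := (pow_pos hm0 2).trans_le hz
    exact ⟨hz', logHomotopy_denom_pos ht (Real.sqrt_pos.2 hz')⟩
  · rintro ⟨⟨⟨x, y⟩, hxy⟩, θ⟩ t ht
    dsimp only at hxy ⊢
    obtain ⟨hqm, hqM⟩ := (hQ x t (hxρ hxy) ht).1
    have hq := hQpos (hxρ hxy) ht
    have hPle : |P x y t| ≤ ρ * (1 + 1 / m) := by
      rw [hP, abs_mul]
      refine mul_le_mul (hyρ hxy) ?_ (abs_nonneg _) hρ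
      have h0 : 0 ≤ t / Q x t := div_nonneg ht.1 hq.le
      have h1 : t / Q x t ≤ 1 / m := div_le_div₀ zero_le_one ht.2 hm0 hqm
      rw [abs_of_nonneg (by linarith [ht.2])]
      linarith [ht.1]
    have hQle : |Q x t| ≤ M := by rwa [abs_of_pos hq]
    refine ⟨ht, ?_, ?_⟩
    · rw [mem_closedBall_zero_iff, Prod.norm_def]
      exact max_le (norm_mul_ofReal_le_of_abs_le hQle hPle (Real.abs_cos_le_one θ))
        (norm_mul_ofReal_le_of_abs_le hQle hPle (Real.abs_sin_le_one θ))
    · have h := Real.sin_sq_add_cos_sq θ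
      have e : (Z x y t * Real.cos θ : ℂ).re ^ 2 + (Z x y t * Real.sin θ : ℂ).re ^ 2 =
          Q x t ^ 2 := by
        simp only [hZ, Complex.add_re, Complex.ofReal_re, Complex.mul_re,
          Complex.ofReal_im, Complex.I_re, Complex.I_im]
        linear_combination Q x t ^ 2 * h
      rw [mem_ofPred_eq, e]
      exact pow_le_pow_left₀ hm0.le hqm 2
  · rintro ⟨⟨⟨x, y⟩, hxy⟩, θ⟩ t ht
    dsimp only at hxy ⊢
    have hq := hQpos (hxρ hxy) ht
    have hden := logHomotopy_denom_pos ht hq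
    rw [hamVec_fderiv_radialHamiltonian hq (hasDerivAt_logRate b t hq hden)]
    have hq' := hasDerivWithinAt_of_logHomotopy_eq (fun t ht => hQpos (hxρ hxy) ht)
      (fun t ht => (hQ x t (hxρ hxy) ht).2) ht
    have hid := hasDerivWithinAt_id t (Icc (0 : ℝ) 1)
    -- This is the momentum equation `P' = -P ∂v/∂q` for `v = q · logRate`, with the derivative of
    -- `logRate` written out.
    have hp' : HasDerivWithinAt (P x y) (-(P x y t * (logRate b t (Q x t) + Q x t *
        (((1 - 1 / Q x t) - logRate b t (Q x t) * (1 - t)) / ((1 - t) * Q x t + t)))))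
        (Icc (0 : ℝ) 1) t := by
      refine (((hid.const_sub 1).add (hid.div hq' hq.ne')).const_mul y).congr_deriv ?_
      have hden' : Q x t * (1 - t) + t ≠ 0 := by
        rw [mul_comm]
        exact hden.ne'
      simp only [hP, id]
      field_simp
      ring
    have hZ' := hq'.ofReal_comp.add (hp'.ofReal_comp.mul_const Complex.I)
    exact (hZ'.mul_const _).prodMk (hZ'.mul_const _)
  · ext w
    simp only [mem_range, Prod.exists, Subtype.exists]
    have hZ0 : ∀ {x y : ℝ}, x ^ 2 + y ^ 2 = ρ ^ 2 →
        Z x y 0 = ((b + x : ℝ) : ℂ) + y * Complex.I := fun {x y} hxy => by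
      simp [hZ, hP, hQ0 (hxρ hxy)]
    have hsphere : ∀ c : ℂ, c ∈ Metric.sphere (b : ℂ) ρ ↔ ∃ x y : ℝ, x ^ 2 + y ^ 2 = ρ ^ 2 ∧
        c = ((b + x : ℝ) : ℂ) + y * Complex.I := fun c => by
      rw [mem_sphere_iff_norm, ← sq_eq_sq₀ (norm_nonneg _) hρ, Complex.sq_norm,
        Complex.normSq_apply]
      constructor
      · intro h
        refine ⟨c.re - b, c.im, by simpa [sq] using h, ?_⟩
        rw [add_sub_cancel, Complex.re_add_im]
      · rintro ⟨x, y, hxy, rfl⟩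
        simpa [sq] using hxy
    constructor
    · rintro ⟨x, y, hxy, θ, rfl⟩
      refine ⟨_, ?_, θ, rfl⟩
      exact (hsphere _).2 ⟨x, y, hxy, hZ0 hxy⟩
    · rintro ⟨c, hc, θ, rfl⟩
      obtain ⟨x, y, hxy, rfl⟩ := (hsphere c).1 hc
      exact ⟨x, y, hxy, θ, by rw [hZ0 hxy]⟩
  · ext w
    simp only [mem_range, Prod.exists, Subtype.exists]
    have hZ1 : ∀ {x y : ℝ}, x ^ 2 + y ^ 2 = ρ ^ 2 →
        Z x y 1 = Real.exp x + Complex.I * Real.exp (-x) * y := fun {x y} hxy => by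
      simp only [hZ, hP, hQ1 (hxρ hxy), Real.exp_neg]
      push_cast
      ring
    constructor
    · rintro ⟨x, y, hxy, θ, rfl⟩
      exact ⟨_, ⟨x, y, hxy, hZ1 hxy⟩, θ, rfl⟩
    · rintro ⟨c, ⟨x, y, hxy, rfl⟩, θ, rfl⟩
      exact ⟨x, y, hxy, θ, by rw [hZ1 hxy]⟩

/-! ### Assembly -/

theorem thetaCh_eq_rotationTorus (r : ℝ) :
    thetaCh r = rotationTorus {c | ∃ x y : ℝ, x ^ 2 + y ^ 2 = (√2 * r) ^ 2 ∧
      c = Real.exp x + Complex.I * Real.exp (-x) * y} := by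
  have h : (√2 * r) ^ 2 = 2 * r ^ 2 := by rw [mul_pow, Real.sq_sqrt (by norm_num)]
  ext w
  simp only [h]
  constructor
  · rintro ⟨θ, x, y, hxy, rfl⟩
    exact ⟨_, ⟨x, y, hxy, rfl⟩, θ, by simp [chekanovEmbedding]⟩
  · rintro ⟨_, ⟨x, y, hxy, rfl⟩, θ, rfl⟩
    exact ⟨θ, x, y, hxy, by simp [chekanovEmbedding]⟩

theorem mainTheorem3 (r : ℝ) (hr : 0 < r) (a : ℂ) (ha : (0 : ℂ) ∉ Metric.closedBall a r) :
    HamiltonianIsotopic (thetaEP a r) (thetaCh r) := by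
  have har : r < ‖a‖ := by simpa [Metric.mem_closedBall, dist_eq_norm] using ha
  have hS : (0 : ℝ) < √2 := by positivity
  rw [thetaCh_eq_rotationTorus]
  refine (hamiltonianIsotopic_unitaryFlow (-(π / 4) - a.arg) (isBounded_thetaEP a r)).trans ?_
  rw [unitaryFlow_image_thetaEP]
  exact hamiltonianIsotopic_rotationTorus_sphere (by positivity) (mul_lt_mul_of_pos_left har hS)
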